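/- Let $\mathbb F$ be a field of characteristic $0$. Let $\boxtimes$ be the tetrahedron Lie algebra over $\mathbb F$: it has generators $x_{ij}$ ($i,j\in\{0,1,2,3\}$, $i\neq j$) and relations (1) $x_{ij}+x_{ji}=0$ for distinct $i,j$; (2) $[x_{hi},x_{ij}]=2x_{hi}+2x_{ij}$ for mutually distinct $h,i,j$; (3) $[x_{hi},[x_{hi},[x_{hi},x_{jk}]]]=4[x_{hi},x_{jk}]$ for mutually distinct $h,i,j,k$. Let $\mathcal O$ be the Lie subalgebra of $\boxtimes$ generated by $x_{12}$ and $x_{03}$. Define subspaces $\mathcal U_0=\operatorname{Span}\{x_{12},x_{03}\}$ and $\mathcal U_{i+1}=\mathcal U_i+[\mathcal U_0,\mathcal U_i]$ for $i\ge 0$, where $[\mathcal U_0,\mathcal U_i]$ is the span of all $[u,v]$ with $u\in\mathcal U_0$, $v\in\mathcal U_i$. Define elements of $\mathcal O$ by $a_0=x_{12}$, $b_0=x_{03}$ and, for $j\ge 1$, $$a_{2j-1}=[b_0,a_{2j-2}],\quad a_{2j}=[a_0,a_{2j-1}],\quad b_{2j-1}=[a_0,b_{2j-2}],\quad b_{2j}=[b_0,b_{2j-1}],$$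 and let $U_i=\operatorname{Span}\{a_i,b_i\}$ for $i\ge 0$. Then: (i) For each odd $i\ge 0$, $a_i\neq 0$ and $b_i=-a_i$; the element $a_i$ is a basis for $U_i$. (ii) For each even $i\ge 0$, $a_i$ and $b_i$ are linearly independent; the elements $a_i,b_i$ are a basis for $U_i$. (iii) For each $i\ge 0$, $\mathcal U_i=U_0+U_1+\cdots+U_i$, and this sum is direct. (iv) $\mathcal O=\sum_{i\ge 0}U_i$, and this sum is direct. -/

import Mathlib

namespace Tetrahedron

/-- The index set of the standard generators: ordered pairs of distinct elements of `{0, 1, 2, 3}`. -/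
abbrev Idx : Type := {p : Fin 4 × Fin 4 // p.1 ≠ p.2}

section Presentation

variable (F : Type*) [Field F]

/-- The free generator `X_ij` of the free Lie algebra on the twelve symbols. -/
noncomputable def freeGen (i j : Fin 4) (hij : i ≠ j) : FreeLieAlgebra F Idx :=
  FreeLieAlgebra.of F (⟨(i, j), hij⟩ : Idx)

/-- The defining relators of the tetrahedron algebra, as elements of the free Lie algebra. -/
inductive IsRelator : FreeLieAlgebra F Idx → Prop
  | antisymm (i j : Fin 4) (hij : i ≠ j) :
      IsRelator (freeGen F i j hij + freeGen F j i hij.symm)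
  | bracket (h i j : Fin 4) (hhi : h ≠ i) (hij : i ≠ j) (hhj : h ≠ j) :
      IsRelator (⁅freeGen F h i hhi, freeGen F i j hij⁆
        - ((2 : F) • freeGen F h i hhi + (2 : F) • freeGen F i j hij))
  | dolanGrady (h i j k : Fin 4) (hhi : h ≠ i) (hjk : j ≠ k)
      (hhj : h ≠ j) (hhk : h ≠ k) (hij : i ≠ j) (hik : i ≠ k) :
      IsRelator (⁅freeGen F h i hhi, ⁅freeGen F h i hhi,
          ⁅freeGen F h i hhi, freeGen F j k hjk⁆⁆⁆
        - (4 : F) • ⁅freeGen F h i hhi, freeGen F j k hjk⁆)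

/-- The ideal of the free Lie algebra generated by the relators. -/
noncomputable def relIdeal : LieIdeal F (FreeLieAlgebra F Idx) :=
  LieSubmodule.lieSpan F (FreeLieAlgebra F Idx) {r | IsRelator F r}

/-- The tetrahedron algebra `⊠` over `F`, presented by generators and relations. -/
abbrev TetAlg : Type _ := FreeLieAlgebra F Idx ⧸ relIdeal F

/-- The standard generator `x_ij` of `⊠`. -/
noncomputable def x (i j : Fin 4) (hij : i ≠ j) : TetAlg F :=
  LieSubmodule.Quotient.mk (freeGen F i j hij)

/-- The standard generator `x_12`. -/
noncomputable def x12 : TetAlg F := x F 1 2 (by decide)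

/-- The standard generator `x_03`. -/
noncomputable def x03 : TetAlg F := x F 0 3 (by decide)

/-- The Onsager subalgebra `𝒪` of `⊠`: the Lie subalgebra generated by `x_12` and `x_03`. -/
noncomputable def onsager : LieSubalgebra F (TetAlg F) :=
  LieSubalgebra.lieSpan F (TetAlg F) {x12 F, x03 F}

/-- The filtration `𝒰_0 = Span {x_12, x_03}`, `𝒰_{i+1} = 𝒰_i + [𝒰_0, 𝒰_i]`, where `[𝒰_0, 𝒰_i]`
is the span of all brackets `[u, v]` with `u ∈ 𝒰_0` and `v ∈ 𝒰_i`. -/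
noncomputable def filt : ℕ → Submodule F (TetAlg F)
  | 0 => Submodule.span F {x12 F, x03 F}
  | i + 1 => filt i ⊔ Submodule.span F
      {w | ∃ u ∈ Submodule.span F {x12 F, x03 F}, ∃ v ∈ filt i, w = ⁅u, v⁆}

/-- The sequence `a_0 = x_12`, `a_{2j-1} = [x_03, a_{2j-2}]`, `a_{2j} = [x_12, a_{2j-1}]`. -/
noncomputable def a : ℕ → TetAlg F
  | 0 => x12 F
  | n + 1 => if Even n then ⁅x03 F, a n⁆ else ⁅x12 F, a n⁆

/-- The sequence `b_0 = x_03`, `b_{2j-1} = [x_12, b_{2j-2}]`, `b_{2j} = [x_03, b_{2j-1}]`. -/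
noncomputable def b : ℕ → TetAlg F
  | 0 => x03 F
  | n + 1 => if Even n then ⁅x12 F, b n⁆ else ⁅x03 F, b n⁆

/-- The subspace `U_i = Span {a_i, b_i}`. -/
noncomputable def U (i : ℕ) : Submodule F (TetAlg F) :=
  Submodule.span F {a F i, b F i}

end Presentation

end Tetrahedron

/-! Put A = `x12`, B = `x03`, c_0 = [A, B], c_{n+1} = [B, [A, c_n]]. Up to sign, c_j is the element
of level 2j+1, and [A, c_j], [B, c_j] are those of level 2j+2. Upper bound: A and B satisfy the
Dolan-Grady relations, and these alone force all c_i to commute and (ad A)² = (ad B)² = 4 on each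
c_k (`altRel_of_dolanGrady`). Hence `a` and `b` agree up to sign at odd levels, and ad A, ad B send
each `U n` into levels at most n+1 (`lie_gen_mem`). This gives the two sum formulas. Lower bound:
four pairwise independent vectors of a plane define a representation of `TetAlg` by traceless 2×2
matrices, with x_ij equal to 1 on the j-th line and -1 on the i-th. Over F(X), with a nonconstant
cross ratio, [B, [A, ·]] multiplies the image of each c_j by 4X. Matrix entries then become
polynomials of distinct degrees, which gives independence (`linearIndependent_onsagerGen`) and
directness. -/

namespace Tetrahedron

/-! ### Consequences of the Dolan-Grady relations -/

section DolanGrady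

variable {F L : Type*} [Field F] [LieRing L] [LieAlgebra F L]

/-- The sequence of iterated brackets `c 0 = [A, B]`, `c (n + 1) = [B, [A, c n]]`. -/
def altBracket (A B : L) : ℕ → L
  | 0 => ⁅A, B⁆
  | n + 1 => ⁅B, ⁅A, altBracket A B n⁆⁆

lemma altBracket_succ (A B : L) (n : ℕ) :
    altBracket A B (n + 1) = ⁅B, ⁅A, altBracket A B n⁆⁆ := rfl

variable (F) in
/-- The relations satisfied up to level `n` by the alternating brackets of a Dolan-Grady pair. -/
structure AltRel (A B : L) (n : ℕ) : Prop where
  comm : ∀ i k, i + k ≤ n → ⁅altBracket A B i, altBracket A B k⁆ = 0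
  left : ∀ k ≤ n, ⁅A, ⁅A, altBracket A B k⁆⁆ = (4 : F) • altBracket A B k
  right : ∀ k ≤ n, ⁅B, ⁅B, altBracket A B k⁆⁆ = (4 : F) • altBracket A B k

variable {A B : L} {n : ℕ}

/-- The action of `[[A, B], y]` written with the actions of `A` and `B`. -/
lemma altBracket_zero_lie (y : L) :
    ⁅altBracket A B 0, y⁆ = ⁅A, ⁅B, y⁆⁆ - ⁅B, ⁅A, y⁆⁆ := by
  rw [altBracket, lie_lie]

lemma lie_lie_lie_expand (u v w y : L) :
    ⁅⁅u, ⁅v, w⁆⁆, y⁆ = ⁅u, ⁅v, ⁅w, y⁆⁆⁆ - ⁅u, ⁅w, ⁅v, y⁆⁆⁆ - ⁅v, ⁅w, ⁅u, y⁆⁆⁆ + ⁅w, ⁅v, ⁅u, y⁆⁆⁆ := by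
  rw [lie_lie, lie_lie, lie_lie, lie_sub]
  abel

/-- Since c_0 = [A, B] kills c_k, ad A and ad B commute on c_k. -/
lemma AltRel.left_right (h : AltRel F A B n) {k : ℕ} (hk : k ≤ n) :
    ⁅A, ⁅B, altBracket A B k⁆⁆ = altBracket A B (k + 1) := by
  have h0 := h.comm 0 k (by omega)
  rw [altBracket_zero_lie, sub_eq_zero] at h0
  rw [h0, altBracket]

lemma AltRel.lie_left (h : AltRel F A B n) (i : ℕ) : ∀ k, i + k ≤ n →
    ⁅altBracket A B i, ⁅A, altBracket A B k⁆⁆ =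
      ⁅A, altBracket A B (i + k + 1)⁆ - (4 : F) • ⁅B, altBracket A B (i + k)⁆ := by
  induction i with
  | zero =>
    intro k hk
    rw [altBracket_zero_lie, h.left k (by omega), lie_smul, zero_add, ← altBracket_succ]
  | succ i ih =>
    intro k hk
    rw [altBracket_succ, lie_lie_lie_expand, h.left k (by omega), ih k (by omega),
      ← altBracket_succ, h.comm i (k + 1) (by omega), lie_smul, h.comm i k (by omega),
      ih (k + 1) (by omega)]
    simp only [lie_sub, lie_smul, h.left_right (show i + k ≤ n by omega),
      h.left (i + k + 1) (by omega), smul_zero, lie_zero]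
    rw [show i + (k + 1) = i + 1 + k by omega, show i + k + 1 = i + 1 + k by omega]
    simp only [sub_self, zero_add]

lemma AltRel.lie_right (h : AltRel F A B n) (i : ℕ) : ∀ k, i + k ≤ n →
    ⁅altBracket A B i, ⁅B, altBracket A B k⁆⁆ =
      (4 : F) • ⁅A, altBracket A B (i + k)⁆ - ⁅B, altBracket A B (i + k + 1)⁆ := by
  induction i with
  | zero =>
    intro k hk
    rw [altBracket_zero_lie, h.right k (by omega), h.left_right (by omega), lie_smul, zero_add]
  | succ i ih =>
    intro k hk
    rw [← h.left_right (show i ≤ n by omega), lie_lie_lie_expand, h.right k (by omega),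
      ih k (by omega), h.left_right (show k ≤ n by omega), h.comm i (k + 1) (by omega),
      lie_smul, h.comm i k (by omega), ih (k + 1) (by omega)]
    simp only [lie_sub, lie_smul, ← altBracket_succ,
      h.right (i + k + 1) (by omega), smul_zero, lie_zero]
    rw [show i + (k + 1) = i + 1 + k by omega, show i + k + 1 = i + 1 + k by omega]
    simp only [sub_self, zero_add]

/-- Apply ad A ad B to [c_i, c_k] = 0. The mixed terms [[B, c_i], [A, c_k]] and [[A, c_i], [B, c_k]]
are evaluated through `lie_left` and `lie_right`, where the multiples of c_n cancel. -/
lemma AltRel.lie_succ_step (h : AltRel F A B n) (i k : ℕ) (hik : i + k = n) :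
    ⁅altBracket A B (i + 1), altBracket A B k⁆ =
      ⁅altBracket A B i, altBracket A B (k + 1)⁆
        + ⁅altBracket A B 0, altBracket A B (n + 1)⁆ := by
  have hl := h.lie_left i k hik.le
  have hr := h.lie_right i k hik.le
  have e0 : ⁅A, ⁅B, ⁅altBracket A B i, altBracket A B k⁆⁆⁆ = 0 := by
    rw [h.comm i k hik.le, lie_zero, lie_zero]
  rw [leibniz_lie B, lie_add, leibniz_lie A ⁅B, altBracket A B i⁆,
    leibniz_lie A (altBracket A B i), h.left_right (show i ≤ n by omega),
    h.left_right (show k ≤ n by omega)] at e0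
  have e1 : ⁅B, ⁅altBracket A B i, ⁅A, altBracket A B k⁆⁆⁆ =
      ⁅⁅B, altBracket A B i⁆, ⁅A, altBracket A B k⁆⁆
        + ⁅altBracket A B i, altBracket A B (k + 1)⁆ := leibniz_lie _ _ _
  have e2 : ⁅A, ⁅altBracket A B i, ⁅B, altBracket A B k⁆⁆⁆ =
      ⁅⁅A, altBracket A B i⁆, ⁅B, altBracket A B k⁆⁆
        + ⁅altBracket A B i, altBracket A B (k + 1)⁆ := by
    rw [leibniz_lie, h.left_right (show k ≤ n by omega)]
  have e3 : ⁅altBracket A B 0, altBracket A B (n + 1)⁆ = _ := altBracket_zero_lie _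
  rw [hl, hik, lie_sub, lie_smul, h.right n le_rfl] at e1
  rw [hr, hik, lie_sub, lie_smul, h.left n le_rfl] at e2
  linear_combination (norm := module) e0 - e3 + e1 + e2

variable [CharZero F]

/-- Applying (ad x)² to [u, v] = 0 leaves 2[[x, u], [x, v]] = 0. -/
lemma lie_lie_lie_eq_zero {x u v : L} (hu : ⁅x, ⁅x, u⁆⁆ = (4 : F) • u)
    (hv : ⁅x, ⁅x, v⁆⁆ = (4 : F) • v) (huv : ⁅u, v⁆ = 0) : ⁅⁅x, u⁆, ⁅x, v⁆⁆ = 0 := by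
  have e1 : ⁅⁅x, u⁆, v⁆ + ⁅u, ⁅x, v⁆⁆ = 0 := by rw [← leibniz_lie, huv, lie_zero]
  have e2 := congrArg (fun z => ⁅x, z⁆) e1
  simp only [lie_add, lie_zero] at e2
  rw [leibniz_lie x ⁅x, u⁆, leibniz_lie x u, hu, hv, smul_lie, lie_smul, huv, smul_zero, zero_add,
    add_zero, ← two_smul F, smul_eq_zero_iff_right two_ne_zero] at e2
  exact e2

/-- Compute [A, [c_0, [A, c_n]]] twice: it vanishes by the Leibniz rule, and `lie_left` turns it
into the difference of the two sides. -/
lemma AltRel.succ_left (h : AltRel F A B n) :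
    ⁅A, ⁅A, altBracket A B (n + 1)⁆⁆ = (4 : F) • altBracket A B (n + 1) := by
  have hc := h.comm 0 n (by omega)
  have h2 : ⁅A, ⁅altBracket A B 0, ⁅A, altBracket A B n⁆⁆⁆ = 0 := by
    rw [leibniz_lie, lie_lie_lie_eq_zero (h.left 0 (by omega)) (h.left n le_rfl) hc,
      h.left n le_rfl, lie_smul, hc, smul_zero, add_zero]
  rw [h.lie_left 0 n (by omega), lie_sub, lie_smul, zero_add, h.left_right le_rfl] at h2
  exact sub_eq_zero.mp h2

lemma AltRel.succ_right (h : AltRel F A B n) :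
    ⁅B, ⁅B, altBracket A B (n + 1)⁆⁆ = (4 : F) • altBracket A B (n + 1) := by
  have hc := h.comm 0 n (by omega)
  have h2 : ⁅B, ⁅altBracket A B 0, ⁅B, altBracket A B n⁆⁆⁆ = 0 := by
    rw [leibniz_lie, lie_lie_lie_eq_zero (h.right 0 (by omega)) (h.right n le_rfl) hc,
      h.right n le_rfl, lie_smul, hc, smul_zero, add_zero]
  rw [h.lie_right 0 n (by omega), lie_sub, lie_smul, zero_add, ← altBracket_succ] at h2
  exact (sub_eq_zero.mp h2).symm

/-- The recurrence makes [c_i, c_k] equal to (i+1)[c_0, c_{n+1}]. At i = n+1 skew-symmetry gives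
(n+3)[c_0, c_{n+1}] = 0, and characteristic 0 finishes. -/
lemma AltRel.comm_succ (h : AltRel F A B n) : ∀ i k, i + k = n + 1 →
    ⁅altBracket A B i, altBracket A B k⁆ = 0 := by
  have key : ∀ i k, i + k = n + 1 → ⁅altBracket A B i, altBracket A B k⁆ =
      ((i + 1 : ℕ) : F) • ⁅altBracket A B 0, altBracket A B (n + 1)⁆ := by
    intro i
    induction i with
    | zero => intro k hk; obtain rfl : k = n + 1 := by omega
              simp
    | succ i ih =>
      intro k hk
      rw [h.lie_succ_step i k (by omega), ih (k + 1) (by omega)]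
      push_cast
      module
  have h0 := key (n + 1) 0 rfl
  rw [← lie_skew] at h0
  have h1 : ((n + 3 : ℕ) : F) • ⁅altBracket A B 0, altBracket A B (n + 1)⁆ = 0 := by
    push_cast at h0 ⊢
    linear_combination (norm := module) -h0
  rw [smul_eq_zero_iff_right (Nat.cast_ne_zero.mpr (by omega))] at h1
  intro i k hik
  rw [key i k hik, h1, smul_zero]

theorem altRel_of_dolanGrady (hA : ⁅A, ⁅A, ⁅A, B⁆⁆⁆ = (4 : F) • ⁅A, B⁆)
    (hB : ⁅B, ⁅B, ⁅B, A⁆⁆⁆ = (4 : F) • ⁅B, A⁆) (n : ℕ) : AltRel F A B n := by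
  induction n with
  | zero =>
    refine ⟨fun i k hik => ?_, fun k hk => ?_, fun k hk => ?_⟩
    · obtain ⟨rfl, rfl⟩ : i = 0 ∧ k = 0 := by omega
      exact lie_self _
    · obtain rfl : k = 0 := by omega
      exact hA
    · obtain rfl : k = 0 := by omega
      rw [altBracket, ← lie_skew A B, lie_neg, lie_neg, hB, smul_neg]
  | succ n ih =>
    refine ⟨fun i k hik => ?_, fun k hk => ?_, fun k hk => ?_⟩
    · rcases Nat.le_succ_iff.mp hik with hik | hik
      · exact ih.comm i k hik
      · exact ih.comm_succ i k hik
    · rcases Nat.le_succ_iff.mp hk with hk | rfl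
      · exact ih.left k hk
      · exact ih.succ_left
    · rcases Nat.le_succ_iff.mp hk with hk | rfl
      · exact ih.right k hk
      · exact ih.succ_right

end DolanGrady
-- The spaces `U i` span the filtration and the Onsager subalgebra
section UpperBound

variable (F : Type*) [Field F]

lemma a_zero : a F 0 = x12 F := rfl

lemma b_zero : b F 0 = x03 F := rfl

lemma mk_eq_of_isRelator_sub {r s : FreeLieAlgebra F Idx} (h : IsRelator F (r - s)) :
    (LieSubmodule.Quotient.mk r : TetAlg F) = LieSubmodule.Quotient.mk s :=
  (Submodule.Quotient.eq _).mpr (LieSubmodule.subset_lieSpan h)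

lemma dolanGrady_x12 : ⁅x12 F, ⁅x12 F, ⁅x12 F, x03 F⁆⁆⁆ = (4 : F) • ⁅x12 F, x03 F⁆ :=
  mk_eq_of_isRelator_sub F
    (IsRelator.dolanGrady 1 2 0 3 (by decide) (by decide) (by decide) (by decide) (by decide)
      (by decide))

lemma dolanGrady_x03 : ⁅x03 F, ⁅x03 F, ⁅x03 F, x12 F⁆⁆⁆ = (4 : F) • ⁅x03 F, x12 F⁆ :=
  mk_eq_of_isRelator_sub F
    (IsRelator.dolanGrady 0 3 1 2 (by decide) (by decide) (by decide) (by decide) (by decide)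
      (by decide))

lemma a_even_succ (j : ℕ) : a F (2 * j + 1) = ⁅x03 F, a F (2 * j)⁆ := by
  rw [a, if_pos (even_two_mul j)]

lemma a_odd_succ (j : ℕ) : a F (2 * j + 2) = ⁅x12 F, a F (2 * j + 1)⁆ := by
  rw [a, if_neg (by simp)]

lemma b_even_succ (j : ℕ) : b F (2 * j + 1) = ⁅x12 F, b F (2 * j)⁆ := by
  rw [b, if_pos (even_two_mul j)]

lemma b_odd_succ (j : ℕ) : b F (2 * j + 2) = ⁅x03 F, b F (2 * j + 1)⁆ := by
  rw [b, if_neg (by simp)]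

lemma a_odd (j : ℕ) : a F (2 * j + 1) = -altBracket (x12 F) (x03 F) j := by
  induction j with
  | zero => rw [a_even_succ, altBracket, lie_skew]; rfl
  | succ j ih => rw [a_even_succ, Nat.mul_succ, a_odd_succ, ih, lie_neg, lie_neg, altBracket]

lemma a_even (j : ℕ) : a F (2 * j + 2) = -⁅x12 F, altBracket (x12 F) (x03 F) j⁆ := by
  rw [a_odd_succ, a_odd, lie_neg]

lemma a_mem_U (i : ℕ) : a F i ∈ U F i := Submodule.subset_span (by simp)

lemma b_mem_U (i : ℕ) : b F i ∈ U F i := Submodule.subset_span (by simp)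

lemma filt_mono : Monotone (filt F) :=
  monotone_nat_of_le_succ fun _ => le_sup_left

lemma lie_mem_filt_succ {n : ℕ} {u v : TetAlg F} (hu : u ∈ Submodule.span F {x12 F, x03 F})
    (hv : v ∈ filt F n) : ⁅u, v⁆ ∈ filt F (n + 1) :=
  Submodule.mem_sup_right (Submodule.subset_span ⟨u, hu, v, hv, rfl⟩)

lemma x12_mem_span : x12 F ∈ Submodule.span F {x12 F, x03 F} := Submodule.subset_span (by simp)

lemma x03_mem_span : x03 F ∈ Submodule.span F {x12 F, x03 F} := Submodule.subset_span (by simp)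

lemma a_mem_filt (n : ℕ) : a F n ∈ filt F n := by
  induction n with
  | zero => exact x12_mem_span F
  | succ n ih =>
    rw [a]
    split_ifs
    exacts [lie_mem_filt_succ F (x03_mem_span F) ih, lie_mem_filt_succ F (x12_mem_span F) ih]

lemma b_mem_filt (n : ℕ) : b F n ∈ filt F n := by
  induction n with
  | zero => exact x03_mem_span F
  | succ n ih =>
    rw [b]
    split_ifs
    exacts [lie_mem_filt_succ F (x12_mem_span F) ih, lie_mem_filt_succ F (x03_mem_span F) ih]

lemma U_le_iff (i : ℕ) (S : Submodule F (TetAlg F)) : U F i ≤ S ↔ a F i ∈ S ∧ b F i ∈ S := by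
  rw [U, Submodule.span_le, Set.insert_subset_iff, Set.singleton_subset_iff]
  rfl

lemma U_le_filt (n : ℕ) : U F n ≤ filt F n :=
  (U_le_iff F n _).mpr ⟨a_mem_filt F n, b_mem_filt F n⟩

lemma U_le_iSup_fin {j n : ℕ} (h : j ≤ n) : U F j ≤ ⨆ j : Fin (n + 1), U F j :=
  le_iSup (fun j : Fin (n + 1) => U F j) ⟨j, by omega⟩

lemma a_mem_onsager (n : ℕ) : a F n ∈ onsager F := by
  induction n with
  | zero => exact LieSubalgebra.subset_lieSpan (by simp [a_zero])
  | succ n ih =>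
    rw [a]
    split_ifs
    exacts [(onsager F).lie_mem (LieSubalgebra.subset_lieSpan (by simp)) ih,
      (onsager F).lie_mem (LieSubalgebra.subset_lieSpan (by simp)) ih]

lemma b_mem_onsager (n : ℕ) : b F n ∈ onsager F := by
  induction n with
  | zero => exact LieSubalgebra.subset_lieSpan (by simp [b_zero])
  | succ n ih =>
    rw [b]
    split_ifs
    exacts [(onsager F).lie_mem (LieSubalgebra.subset_lieSpan (by simp)) ih,
      (onsager F).lie_mem (LieSubalgebra.subset_lieSpan (by simp)) ih]

variable [CharZero F]

lemma altRel_x12_x03 (n : ℕ) : AltRel F (x12 F) (x03 F) n :=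
  altRel_of_dolanGrady (dolanGrady_x12 F) (dolanGrady_x03 F) n

lemma b_odd (j : ℕ) : b F (2 * j + 1) = altBracket (x12 F) (x03 F) j := by
  induction j with
  | zero => rw [b_even_succ]; rfl
  | succ j ih =>
    rw [b_even_succ, Nat.mul_succ, b_odd_succ, ih, (altRel_x12_x03 F j).left_right le_rfl]

lemma b_odd_eq_neg_a (j : ℕ) : b F (2 * j + 1) = -a F (2 * j + 1) := by
  rw [b_odd, a_odd, neg_neg]

lemma b_even (j : ℕ) : b F (2 * j + 2) = ⁅x03 F, altBracket (x12 F) (x03 F) j⁆ := by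
  rw [b_odd_succ, b_odd]

/-- Bracketing with a generator sends `U n` into the sum of the `U j` with `j ≤ n + 1`. -/
lemma lie_gen_mem {n : ℕ} {S : Submodule F (TetAlg F)} (hS : ∀ j ≤ n + 1, U F j ≤ S)
    {u v : TetAlg F} (hu : u ∈ Submodule.span F {x12 F, x03 F}) (hv : v ∈ U F n) :
    ⁅u, v⁆ ∈ S := by
  have hrel := fun j => altRel_x12_x03 F j
  have ha : ∀ j ≤ n + 1, a F j ∈ S := fun j hj => hS j hj (a_mem_U F j)
  have hb : ∀ j ≤ n + 1, b F j ∈ S := fun j hj => hS j hj (b_mem_U F j)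
  have key : (⁅x12 F, a F n⁆ ∈ S ∧ ⁅x12 F, b F n⁆ ∈ S) ∧ ⁅x03 F, a F n⁆ ∈ S ∧ ⁅x03 F, b F n⁆ ∈ S := by
    obtain ⟨j, rfl | rfl⟩ := n.even_or_odd'
    · refine ⟨⟨?_, ?_⟩, ?_, ?_⟩
      -- A generator applied again to [generator, c_j] returns to level 2j+1, because its square
      -- acts as 4 on c_j.
      · cases j with
        | zero => rw [Nat.mul_zero, a_zero, lie_self]; exact S.zero_mem
        | succ j =>
          rw [Nat.mul_succ, a_even, lie_neg, (hrel j).left j le_rfl, ← smul_neg, ← a_odd]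
          exact S.smul_mem _ (ha _ (by omega))
      · rw [← b_even_succ]; exact hb _ (by omega)
      · rw [← a_even_succ]; exact ha _ (by omega)
      · cases j with
        | zero => rw [Nat.mul_zero, b_zero, lie_self]; exact S.zero_mem
        | succ j =>
          rw [Nat.mul_succ, b_even, (hrel j).right j le_rfl, ← b_odd]
          exact S.smul_mem _ (hb _ (by omega))
    · have h1 : ⁅x12 F, a F (2 * j + 1)⁆ ∈ S := by rw [← a_odd_succ]; exact ha _ (by omega)
      have h2 : ⁅x03 F, b F (2 * j + 1)⁆ ∈ S := by rw [← b_odd_succ]; exact hb _ (by omega)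
      refine ⟨⟨h1, ?_⟩, ?_, h2⟩
      · rw [b_odd_eq_neg_a, lie_neg]; exact S.neg_mem h1
      · rw [← neg_neg (a F (2 * j + 1)), ← b_odd_eq_neg_a, lie_neg]; exact S.neg_mem h2
  obtain ⟨p, q, rfl⟩ := Submodule.mem_span_pair.mp hu
  obtain ⟨r, t, rfl⟩ := Submodule.mem_span_pair.mp hv
  simp only [add_lie, lie_add, smul_lie, lie_smul]
  exact S.add_mem
    (S.smul_mem _ (S.add_mem (S.smul_mem _ key.1.1) (S.smul_mem _ key.2.1)))
    (S.smul_mem _ (S.add_mem (S.smul_mem _ key.1.2) (S.smul_mem _ key.2.2)))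

lemma lie_iSup_mem {ι : Type*} {f : ι → ℕ} {S : Submodule F (TetAlg F)}
    (hS : ∀ i, ∀ j ≤ f i + 1, U F j ≤ S) {u v : TetAlg F}
    (hu : u ∈ Submodule.span F {x12 F, x03 F}) (hv : v ∈ ⨆ i, U F (f i)) : ⁅u, v⁆ ∈ S := by
  induction hv using Submodule.iSup_induction' with
  | mem i v hv => exact lie_gen_mem F (hS i) hu hv
  | zero => rw [lie_zero]; exact S.zero_mem
  | add v w _ _ hv hw => rw [lie_add]; exact S.add_mem hv hw

theorem filt_eq_iSup (n : ℕ) : filt F n = ⨆ j : Fin (n + 1), U F j := by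
  refine le_antisymm ?_ (iSup_le fun j => ?_)
  · induction n with
    | zero =>
      have h : filt F 0 = U F 0 := by rw [filt, U, a_zero, b_zero]
      rw [h]
      exact U_le_iSup_fin F (j := 0) le_rfl
    | succ n ih =>
      rw [filt]
      refine sup_le (ih.trans (iSup_le fun j => ?_)) ?_
      · exact U_le_iSup_fin F (j := (j : ℕ)) (n := n + 1) (by omega)
      · rw [Submodule.span_le]
        rintro _ ⟨u, hu, v, hv, rfl⟩
        exact lie_iSup_mem F (f := fun i : Fin (n + 1) => (i : ℕ))
          (fun i j hj => U_le_iSup_fin F (j := j) (n := n + 1) (by omega)) hu (ih hv)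
  · exact (U_le_filt F j).trans (filt_mono F (by omega))

theorem onsager_eq_iSup : (onsager F).toSubmodule = ⨆ i : ℕ, U F i := by
  set W := ⨆ i : ℕ, U F i with hW
  have hWO : W ≤ (onsager F).toSubmodule :=
    iSup_le fun i => (U_le_iff F i _).mpr ⟨a_mem_onsager F i, b_mem_onsager F i⟩
  -- The stabilizer of `W` is a subalgebra containing both generators, hence all of `onsager F` and
  -- so `W` itself; thus `W` is closed under brackets.
  let N : LieSubalgebra F (TetAlg F) :=
    { carrier := {y | ∀ w ∈ W, ⁅y, w⁆ ∈ W}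
      zero_mem' := fun w _ => by rw [zero_lie]; exact W.zero_mem
      add_mem' := fun hy hz w hw => by rw [add_lie]; exact W.add_mem (hy w hw) (hz w hw)
      smul_mem' := fun r y hy w hw => by rw [smul_lie]; exact W.smul_mem r (hy w hw)
      lie_mem' := fun hy hz w hw => by
        rw [lie_lie]; exact W.sub_mem (hy _ (hz w hw)) (hz _ (hy w hw)) }
  have hN : onsager F ≤ N := by
    refine LieSubalgebra.lieSpan_le.mpr fun u hu w hw => ?_
    exact lie_iSup_mem F (f := id) (fun i j _ => le_iSup (U F) j) (Submodule.subset_span hu) hw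
  let W' : LieSubalgebra F (TetAlg F) :=
    { W with lie_mem' := fun hy hz => hN (hWO hy) _ hz }
  have hW' : onsager F ≤ W' := by
    refine LieSubalgebra.lieSpan_le.mpr ?_
    rintro u (rfl | rfl)
    exacts [le_iSup (U F) 0 (a_mem_U F 0), le_iSup (U F) 0 (b_mem_U F 0)]
  exact le_antisymm hW' hWO

end UpperBound
-- Representations by 2×2 matrices from four points of the projective line
section Representation

attribute [local instance] LieRing.ofAssociativeRing

variable {K : Type*} [Field K]

lemma lie_fin_two {R : Type*} [CommRing R] (a b c d a' b' c' d' : R) :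
    !![a, b; c, d] * !![a', b'; c', d'] - !![a', b'; c', d'] * !![a, b; c, d] =
      !![b * c' - b' * c, a * b' + b * d' - a' * b - b' * d;
        c * a' + d * c' - c' * a - d' * c, c * b' - c' * b] := by
  rw [Matrix.mul_fin_two, Matrix.mul_fin_two]
  ext i j
  fin_cases i <;> fin_cases j <;> simp <;> ring

/-- The determinant of two vectors of the plane. -/
def det2 (p q : K × K) : K := p.1 * q.2 - p.2 * q.1

/-- The traceless matrix with eigenvalue `1` on `p` and eigenvalue `-1` on `q`. -/
def eigMat (p q : K × K) : Matrix (Fin 2) (Fin 2) K :=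
  (det2 p q)⁻¹ • !![p.1 * q.2 + p.2 * q.1, -(2 * p.1 * q.1);
    2 * p.2 * q.2, -(p.1 * q.2 + p.2 * q.1)]

lemma eigMat_add_swap (p q : K × K) : eigMat p q + eigMat q p = 0 := by
  have h : det2 q p = -det2 p q := by simp only [det2]; ring
  rw [eigMat, eigMat, h]
  ext i j
  fin_cases i <;> fin_cases j <;> simp <;> ring

lemma lie_smul_matrix (c d : K) (M N : Matrix (Fin 2) (Fin 2) K) :
    ⁅c • M, d • N⁆ = (c * d) • (M * N - N * M) := by
  rw [LieRing.of_associative_ring_bracket, smul_sub]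
  simp [smul_smul, mul_comm]

lemma lie_eigMat {p q r : K × K} (hpq : det2 p q ≠ 0) (hqr : det2 q r ≠ 0) :
    ⁅eigMat q p, eigMat r q⁆ = (2 : K) • eigMat q p + (2 : K) • eigMat r q := by
  have hqp : det2 q p ≠ 0 := by
    intro h; apply hpq; rw [← neg_eq_zero, ← h]; simp only [det2]; ring
  have hrq : det2 r q ≠ 0 := by
    intro h; apply hqr; rw [← neg_eq_zero, ← h]; simp only [det2]; ring
  rw [eigMat, eigMat, lie_smul_matrix, lie_fin_two]
  ext i j
  fin_cases i <;> fin_cases j <;> simp <;> field_simp <;>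
    simp only [det2] <;> ring

lemma eigMat_sq {p q : K × K} (hpq : det2 p q ≠ 0) : eigMat p q * eigMat p q = 1 := by
  rw [eigMat, Matrix.smul_mul, Matrix.mul_smul, smul_smul, Matrix.mul_fin_two, Matrix.one_fin_two,
    Matrix.smul_of, ← mul_inv]
  have h : (det2 p q * det2 p q)⁻¹ * (det2 p q * det2 p q) = 1 :=
    inv_mul_cancel₀ (mul_ne_zero hpq hpq)
  ext i j
  fin_cases i <;> fin_cases j <;> simp
  · rw [← mul_inv, ← h, det2]; ring
  · right; ring
  · right; ring
  · rw [← mul_inv, ← h, det2]; ring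

/-- Left and right multiplication by M are commuting involutions, and (L - R)³ = 4(L - R) for any
such pair. -/
lemma lie_lie_lie_of_sq_eq_one {R : Type*} [Ring R] {M : R} (hM : M * M = 1) (N : R) :
    ⁅M, ⁅M, ⁅M, N⁆⁆⁆ = 4 * ⁅M, N⁆ := by
  have h2 : ⁅M, ⁅M, N⁆⁆ = 2 * N - 2 * (M * N * M) := by
    simp only [LieRing.of_associative_ring_bracket]
    have e1 : M * (M * N - N * M) = N - M * N * M := by
      rw [mul_sub, ← mul_assoc, hM, one_mul, mul_assoc]
    have e2 : (M * N - N * M) * M = M * N * M - N := by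
      rw [sub_mul, mul_assoc N, hM, mul_one]
    rw [e1, e2]; noncomm_ring
  rw [h2]
  simp only [LieRing.of_associative_ring_bracket]
  have e1 : M * (M * N * M) = N * M := by rw [← mul_assoc, ← mul_assoc, hM, one_mul]
  have e2 : M * N * M * M = M * N := by rw [mul_assoc, hM, mul_one]
  have e3 : M * (2 * N - 2 * (M * N * M)) = 2 * (M * N) - 2 * (M * (M * N * M)) := by noncomm_ring
  have e4 : (2 * N - 2 * (M * N * M)) * M = 2 * (N * M) - 2 * (M * N * M * M) := by noncomm_ring
  rw [e3, e4, e1, e2]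
  noncomm_ring

variable (F : Type*) [Field F] [Algebra F K]

/-- The homomorphism on the free Lie algebra attached to four points of the plane. -/
noncomputable def freeEval (p : Fin 4 → K × K) :
    FreeLieAlgebra F Idx →ₗ⁅F⁆ Matrix (Fin 2) (Fin 2) K :=
  FreeLieAlgebra.lift F fun ij => eigMat (p ij.1.2) (p ij.1.1)

lemma freeEval_freeGen (p : Fin 4 → K × K) (i j : Fin 4) (hij : i ≠ j) :
    freeEval F p (freeGen F i j hij) = eigMat (p j) (p i) :=
  FreeLieAlgebra.lift_of_apply _ _

lemma relIdeal_le_ker {p : Fin 4 → K × K} (hp : ∀ i j, i ≠ j → det2 (p i) (p j) ≠ 0) :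
    relIdeal F ≤ (freeEval F p).ker := by
  refine LieSubmodule.lieSpan_le.mpr fun r hr => ?_
  rw [SetLike.mem_coe, LieHom.mem_ker]
  have h2 : ∀ M : Matrix (Fin 2) (Fin 2) K, (2 : F) • M = (2 : K) • M := fun M => by
    rw [ofNat_smul_eq_nsmul F 2 M, ofNat_smul_eq_nsmul K 2 M]
  have h4 : ∀ M : Matrix (Fin 2) (Fin 2) K, (4 : F) • M = 4 * M := fun M => by
    rw [ofNat_smul_eq_nsmul F 4 M, nsmul_eq_mul]; rfl
  cases hr with
  | antisymm i j hij =>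
    rw [map_add, freeEval_freeGen, freeEval_freeGen, eigMat_add_swap]
  | bracket h i j hhi hij hhj =>
    simp only [map_add, map_sub, map_smul, LieHom.map_lie, freeEval_freeGen,
      h2, lie_eigMat (hp h i hhi) (hp i j hij), sub_self]
  | dolanGrady h i j k hhi hjk hhj hhk hij hik =>
    simp only [map_sub, map_smul, LieHom.map_lie, freeEval_freeGen, h4,
      lie_lie_lie_of_sq_eq_one (eigMat_sq (hp i h hhi.symm)), sub_self]

/-- The linear map on the tetrahedron algebra attached to four points in general position. -/
noncomputable def tetEval {p : Fin 4 → K × K} (hp : ∀ i j, i ≠ j → det2 (p i) (p j) ≠ 0) :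
    TetAlg F →ₗ[F] Matrix (Fin 2) (Fin 2) K :=
  (relIdeal F).toSubmodule.liftQ
    (freeEval F p : FreeLieAlgebra F Idx →ₗ[F] Matrix (Fin 2) (Fin 2) K)
    (fun _ hr => LieHom.mem_ker.mp (relIdeal_le_ker F hp hr))

lemma tetEval_lie {p : Fin 4 → K × K} (hp : ∀ i j, i ≠ j → det2 (p i) (p j) ≠ 0)
    (y z : TetAlg F) : tetEval F hp ⁅y, z⁆ = ⁅tetEval F hp y, tetEval F hp z⁆ := by
  induction y using Submodule.Quotient.induction_on with | _ y
  induction z using Submodule.Quotient.induction_on with | _ z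
  exact LieHom.map_lie (freeEval F p) y z

lemma tetEval_x {p : Fin 4 → K × K} (hp : ∀ i j, i ≠ j → det2 (p i) (p j) ≠ 0)
    (i j : Fin 4) (hij : i ≠ j) : tetEval F hp (x F i j hij) = eigMat (p j) (p i) :=
  freeEval_freeGen F p i j hij

end Representation

/-! ### The representation over rational functions -/

section RatFuncRepresentation

variable (F : Type*) [Field F]

/-- Four points of the projective line over `F(s)` whose cross ratio is not constant. -/
noncomputable def ratPoints : Fin 4 → RatFunc F × RatFunc F :=
  ![(1, RatFunc.X + 1), (0, 1), (1, 0), (1, RatFunc.X - 1)]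

lemma algebraMap_ne_zero_of_monic {p : Polynomial F} (hp : p.Monic) :
    algebraMap (Polynomial F) (RatFunc F) p ≠ 0 :=
  RatFunc.algebraMap_ne_zero hp.ne_zero

lemma ratX_add_one_ne_zero : (RatFunc.X : RatFunc F) + 1 ≠ 0 := by
  have h := algebraMap_ne_zero_of_monic F (Polynomial.monic_X_add_C (1 : F))
  simpa using h

lemma ratX_sub_one_ne_zero : (RatFunc.X : RatFunc F) - 1 ≠ 0 := by
  have h := algebraMap_ne_zero_of_monic F (Polynomial.monic_X_sub_C (1 : F))
  simpa using h

lemma ratX_sq_sub_one_ne_zero : (RatFunc.X : RatFunc F) ^ 2 - 1 ≠ 0 := by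
  have h := mul_ne_zero (ratX_add_one_ne_zero F) (ratX_sub_one_ne_zero F)
  intro h0; apply h; rw [← h0]; ring

variable [CharZero F]

instance charZero_ratFunc : CharZero (RatFunc F) :=
  charZero_of_injective_algebraMap (algebraMap F (RatFunc F)).injective

lemma det2_ratPoints_ne_zero (i j : Fin 4) (hij : i ≠ j) :
    det2 (ratPoints F i) (ratPoints F j) ≠ 0 := by
  have h1 := ratX_add_one_ne_zero F
  have h2 := ratX_sub_one_ne_zero F
  have h1' := neg_ne_zero.mpr h1
  have h2' := neg_ne_zero.mpr h2
  have e1 : (RatFunc.X : RatFunc F) - 1 - (RatFunc.X + 1) ≠ 0 := by ring_nf; norm_num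
  fin_cases i <;> fin_cases j <;>
    first
    | exact absurd rfl hij
    | simp [ratPoints, det2, h1, h2, h1', h2', e1, -neg_sub, -neg_add_rev]

/-- The representation of the tetrahedron algebra over rational functions. -/
noncomputable def ratEval : TetAlg F →ₗ[F] Matrix (Fin 2) (Fin 2) (RatFunc F) :=
  tetEval F (det2_ratPoints_ne_zero F)

lemma ratEval_x12 : ratEval F (x12 F) = !![1, 0; 0, -1] := by
  rw [ratEval, x12, tetEval_x]
  simp [eigMat, det2, ratPoints]

lemma ratEval_x03 :
    ratEval F (x03 F) = !![RatFunc.X, -1; RatFunc.X ^ 2 - 1, -RatFunc.X] := by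
  rw [ratEval, x03, tetEval_x]
  simp [eigMat, det2, ratPoints]
  ring_nf
  simp

lemma ratEval_lie (y z : TetAlg F) :
    ratEval F ⁅y, z⁆ = ratEval F y * ratEval F z - ratEval F z * ratEval F y :=
  tetEval_lie F _ y z

lemma ratEval_altBracket (j : ℕ) : ratEval F (altBracket (x12 F) (x03 F) j) =
    !![0, -2 * (4 * RatFunc.X) ^ j; -2 * (4 * RatFunc.X) ^ j * (RatFunc.X ^ 2 - 1), 0] := by
  induction j with
  | zero =>
    rw [altBracket, ratEval_lie, ratEval_x12, ratEval_x03, lie_fin_two]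
    ext i j
    fin_cases i <;> fin_cases j <;> simp <;> ring
  | succ j ih =>
    rw [altBracket, ratEval_lie, ratEval_lie, ratEval_x12, ratEval_x03, ih, lie_fin_two,
      lie_fin_two]
    ext i j
    fin_cases i <;> fin_cases j <;> simp [pow_succ] <;> ring

end RatFuncRepresentation
-- Linear independence and directness of the sums
section LinearIndependence

/-- The span of u lies in the kernel of f, while f is injective on the span of v, so the spans meet
trivially. -/
lemma linearIndependent_sumElim_of_map {F V W ι κ : Type*} [Field F] [AddCommGroup V] [Module F V]
    [AddCommGroup W] [Module F W] (f : V →ₗ[F] W) {u : ι → V} {v : κ → V}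
    (hfu : ∀ i, f (u i) = 0) (hu : LinearIndependent F u) (hv : LinearIndependent F (f ∘ v)) :
    LinearIndependent F (Sum.elim u v) := by
  refine hu.sum_type hv.of_comp ?_
  rw [Submodule.disjoint_def]
  intro y hyu hyv
  have h0 : f y = 0 := by
    have hle : Submodule.span F (Set.range u) ≤ LinearMap.ker f := by
      rw [Submodule.span_le]
      rintro _ ⟨i, rfl⟩
      exact hfu i
    exact hle hyu
  obtain ⟨l, rfl⟩ := (Finsupp.mem_span_range_iff_exists_finsupp).mp hyv
  have h1 : Finsupp.linearCombination F (f ∘ v) l = 0 := by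
    rw [← h0, ← Finsupp.linearCombination_apply, Finsupp.apply_linearCombination]
  rw [linearIndependent_iff.mp hv l h1, Finsupp.sum_zero_index]

lemma iSupIndep_span_image_fiber {F V ι κ : Type*} [Field F] [AddCommGroup V] [Module F V]
    {v : ι → V} (hv : LinearIndependent F v) (f : ι → κ) :
    iSupIndep fun k => Submodule.span F (v '' (f ⁻¹' {k})) := by
  intro k
  refine (hv.disjoint_span_image (s := f ⁻¹' {k}) (t := f ⁻¹' {k}ᶜ) ?_).mono_right ?_
  · exact Disjoint.preimage f disjoint_compl_right
  · refine iSup₂_le fun l hl => Submodule.span_mono (Set.image_mono (Set.preimage_mono ?_))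
    simpa using Ne.symm hl

variable (F : Type*) [Field F]

lemma linearIndependent_algebraMap_ratFunc {p : ℕ → Polynomial F}
    (hp : ∀ n, (p n).degree = n) :
    LinearIndependent F fun n => algebraMap (Polynomial F) (RatFunc F) (p n) := by
  have h := (Polynomial.Sequence.linearIndependent ⟨p, hp⟩).map'
    (IsScalarTower.toAlgHom F (Polynomial F) (RatFunc F)).toLinearMap
    (LinearMap.ker_eq_bot.mpr (RatFunc.algebraMap_injective F))
  exact h

lemma ratFunc_C_four : (RatFunc.C (4 : F)) = 4 := map_ofNat _ 4

lemma exists_basis_of_span_range_eq {V ι : Type*} [AddCommGroup V] [Module F V] {v : ι → V}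
    (hv : LinearIndependent F v) {S : Submodule F V} (hS : Submodule.span F (Set.range v) = S) :
    ∃ B : Module.Basis ι F S, ∀ i, (B i : V) = v i := by
  subst hS
  exact ⟨Module.Basis.span hv, fun i => congrArg Subtype.val (Module.Basis.span_apply hv i)⟩

/-- The basis of the Onsager algebra, arranged in three sequences. -/
noncomputable def onsagerGen : (ℕ ⊕ ℕ) ⊕ ℕ → TetAlg F :=
  Sum.elim (Sum.elim (fun j => a F (2 * j + 2)) (fun j => a F (2 * j + 1)))
    (fun n => n.casesOn (a F 0) (fun j => b F (2 * j)))

/-- The level of an element of `onsagerGen`. -/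
def onsagerLevel : (ℕ ⊕ ℕ) ⊕ ℕ → ℕ :=
  Sum.elim (Sum.elim (fun j => 2 * j + 2) (fun j => 2 * j + 1))
    (fun n => n.casesOn 0 (fun j => 2 * j))

variable [CharZero F]

lemma ratEval_a_odd (j : ℕ) : ratEval F (a F (2 * j + 1)) =
    !![0, 2 * (4 * RatFunc.X) ^ j; 2 * (4 * RatFunc.X) ^ j * (RatFunc.X ^ 2 - 1), 0] := by
  rw [a_odd, map_neg, ratEval_altBracket]
  ext i k
  fin_cases i <;> fin_cases k <;> simp

lemma ratEval_a_even (j : ℕ) : ratEval F (a F (2 * j + 2)) =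
    !![0, 4 * (4 * RatFunc.X) ^ j; -(4 * (4 * RatFunc.X) ^ j * (RatFunc.X ^ 2 - 1)), 0] := by
  rw [a_odd_succ, ratEval_lie, ratEval_x12, ratEval_a_odd, lie_fin_two]
  ext i k
  fin_cases i <;> fin_cases k <;> simp <;> ring

lemma ratEval_b_even_zero_zero (j : ℕ) : ratEval F (b F (2 * j + 2)) 0 0 =
    4 * (4 * RatFunc.X) ^ j * (RatFunc.X ^ 2 - 1) := by
  rw [b_even, ratEval_lie, ratEval_x03, ratEval_altBracket, lie_fin_two]
  simp
  ring

/-- The linear map reading an entry of the representing matrix. -/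
noncomputable def ratEntry (i j : Fin 2) : TetAlg F →ₗ[F] RatFunc F :=
  Matrix.entryLinearMap F (RatFunc F) i j ∘ₗ ratEval F

lemma ratEntry_apply (i j : Fin 2) (y : TetAlg F) : ratEntry F i j y = ratEval F y i j := rfl

lemma degree_four_mul_pow (n : ℕ) :
    (Polynomial.C 4 * (Polynomial.C 4 * Polynomial.X) ^ n : Polynomial F).degree = n := by
  have h4 : (4 : F) ≠ 0 := by norm_num
  rw [mul_pow, ← Polynomial.C_pow, ← mul_assoc, ← Polynomial.C_mul,
    Polynomial.degree_C_mul_X_pow _ (mul_ne_zero h4 (pow_ne_zero _ h4))]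

lemma linearIndependent_four_mul_pow :
    LinearIndependent F fun n : ℕ => (4 : RatFunc F) * (4 * RatFunc.X) ^ n := by
  have h := linearIndependent_algebraMap_ratFunc F (degree_four_mul_pow F)
  simpa [ratFunc_C_four] using h

theorem linearIndependent_onsagerGen : LinearIndependent F (onsagerGen F) := by
  have hq := ratX_sq_sub_one_ne_zero F
  -- The diagonal entry kills every a_i with i ≥ 1. The weighted sum of off-diagonal entries then
  -- separates odd from even: it kills a_{2j+2} and sends a_{2j+1} to 4(4X)^j.
  refine linearIndependent_sumElim_of_map (ratEntry F 0 0) ?_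
    (linearIndependent_sumElim_of_map (ratEntry F 0 1 +
      (LinearMap.mulLeft F (RatFunc.X ^ 2 - 1)⁻¹) ∘ₗ ratEntry F 1 0) ?_
      (LinearIndependent.of_comp (ratEntry F 0 1) ?_) ?_) ?_
  · rintro (j | j)
    · simp [ratEntry_apply, ratEval_a_even]
    · simp [ratEntry_apply, ratEval_a_odd]
  · intro j
    simp [ratEntry_apply, ratEval_a_even]
    field_simp
    ring
  · have e : (ratEntry F 0 1 ∘ fun j => a F (2 * j + 2)) =
        fun j => 4 * (4 * RatFunc.X) ^ j := by
      ext j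
      simp [ratEntry_apply, ratEval_a_even]
    rw [e]
    exact linearIndependent_four_mul_pow F
  · have e : ((ratEntry F 0 1 + (LinearMap.mulLeft F (RatFunc.X ^ 2 - 1)⁻¹) ∘ₗ ratEntry F 1 0) ∘
        fun j => a F (2 * j + 1)) = fun j => 4 * (4 * RatFunc.X) ^ j := by
      ext j
      simp [ratEntry_apply, ratEval_a_odd]
      field_simp
      ring
    rw [e]
    exact linearIndependent_four_mul_pow F
  -- The diagonal entries of a_0, b_0, b_2, b_4, … have degrees 0, 1, 2, 3, …
  · let p : ℕ → Polynomial F := fun n => n.casesOn 1 fun n => n.casesOn Polynomial.X fun j =>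
      Polynomial.C 4 * (Polynomial.C 4 * Polynomial.X) ^ j * (Polynomial.X ^ 2 - Polynomial.C 1)
    have hp : ∀ n, (p n).degree = n := by
      rintro (_ | _ | j)
      · exact Polynomial.degree_one
      · exact Polynomial.degree_X
      · change (_ * _ : Polynomial F).degree = _
        rw [Polynomial.degree_mul, degree_four_mul_pow, Polynomial.degree_X_pow_sub_C two_pos]
        norm_cast
    have e : (ratEntry F 0 0 ∘ fun n : ℕ => (n.casesOn (a F 0) (fun j => b F (2 * j)) : TetAlg F)) =
        fun n => algebraMap (Polynomial F) (RatFunc F) (p n) := by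
      ext n
      rcases n with _ | _ | j
      · simp [ratEntry_apply, a_zero, ratEval_x12, p]
      · simp [ratEntry_apply, b_zero, ratEval_x03, p]
      · simp [ratEntry_apply, Nat.mul_succ, ratEval_b_even_zero_zero, p, ratFunc_C_four]
    rw [e]
    exact linearIndependent_algebraMap_ratFunc F hp

lemma a_odd_ne_zero (j : ℕ) : a F (2 * j + 1) ≠ 0 :=
  (linearIndependent_onsagerGen F).ne_zero (Sum.inl (Sum.inr j))

lemma linearIndependent_a_b_even (j : ℕ) :
    LinearIndependent F ![a F (2 * j), b F (2 * j)] := by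
  cases j with
  | zero =>
    have h := (linearIndependent_onsagerGen F).comp ![Sum.inr 0, Sum.inr 1] (by
      intro i k; fin_cases i <;> fin_cases k <;> simp)
    convert h using 1
    ext i
    fin_cases i <;> rfl
  | succ j =>
    have h := (linearIndependent_onsagerGen F).comp ![Sum.inl (Sum.inl j), Sum.inr (j + 2)] (by
      intro i k; fin_cases i <;> fin_cases k <;> simp)
    convert h using 1
    ext i
    fin_cases i <;> rfl

lemma U_odd (j : ℕ) : U F (2 * j + 1) = Submodule.span F {a F (2 * j + 1)} := by
  refine le_antisymm ((U_le_iff F _ _).mpr ⟨Submodule.mem_span_singleton_self _, ?_⟩)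
    (Submodule.span_mono (by simp))
  rw [b_odd_eq_neg_a]
  exact Submodule.neg_mem _ (Submodule.mem_span_singleton_self _)

lemma U_le_span_fiber (i : ℕ) :
    U F i ≤ Submodule.span F (onsagerGen F '' (onsagerLevel ⁻¹' {i})) := by
  obtain ⟨j, rfl | rfl⟩ := i.even_or_odd'
  · refine (U_le_iff F _ _).mpr ⟨Submodule.subset_span ?_,
      Submodule.subset_span ⟨Sum.inr (j + 1), rfl, rfl⟩⟩
    cases j with
    | zero => exact ⟨Sum.inr 0, rfl, rfl⟩
    | succ j => exact ⟨Sum.inl (Sum.inl j), rfl, rfl⟩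
  · rw [U_odd, Submodule.span_le, Set.singleton_subset_iff]
    exact Submodule.subset_span ⟨Sum.inl (Sum.inr j), rfl, rfl⟩

theorem iSupIndep_U : iSupIndep (U F) :=
  (iSupIndep_span_image_fiber (linearIndependent_onsagerGen F) onsagerLevel).mono
    (U_le_span_fiber F)

end LinearIndependence
end Tetrahedron

theorem mainTheorem6 (F : Type*) [Field F] [CharZero F] :
    (∀ i : ℕ, Odd i →
      Tetrahedron.a F i ≠ 0 ∧
      Tetrahedron.b F i = -Tetrahedron.a F i ∧
      ∃ B : Module.Basis (Fin 1) F (Tetrahedron.U F i),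
        (B 0 : Tetrahedron.TetAlg F) = Tetrahedron.a F i) ∧
    (∀ i : ℕ, Even i →
      LinearIndependent F ![Tetrahedron.a F i, Tetrahedron.b F i] ∧
      ∃ B : Module.Basis (Fin 2) F (Tetrahedron.U F i),
        (B 0 : Tetrahedron.TetAlg F) = Tetrahedron.a F i ∧
        (B 1 : Tetrahedron.TetAlg F) = Tetrahedron.b F i) ∧
    (∀ i : ℕ,
      Tetrahedron.filt F i = (⨆ j : Fin (i + 1), Tetrahedron.U F j) ∧
      iSupIndep (fun j : Fin (i + 1) => Tetrahedron.U F j)) ∧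
    ((Tetrahedron.onsager F).toSubmodule = (⨆ i : ℕ, Tetrahedron.U F i) ∧
      iSupIndep (fun i : ℕ => Tetrahedron.U F i)) := by
  refine ⟨fun i hi => ?_, fun i hi => ?_, fun i => ⟨Tetrahedron.filt_eq_iSup F i, ?_⟩,
    Tetrahedron.onsager_eq_iSup F, Tetrahedron.iSupIndep_U F⟩
  · obtain ⟨j, rfl⟩ := hi
    refine ⟨Tetrahedron.a_odd_ne_zero F j, Tetrahedron.b_odd_eq_neg_a F j, ?_⟩
    obtain ⟨B, hB⟩ := Tetrahedron.exists_basis_of_span_range_eq F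
      (v := fun _ : Fin 1 => Tetrahedron.a F (2 * j + 1))
      (linearIndependent_unique_iff.mpr (Tetrahedron.a_odd_ne_zero F j))
      (S := Tetrahedron.U F (2 * j + 1)) (by rw [Set.range_const, Tetrahedron.U_odd])
    exact ⟨B, hB 0⟩
  · obtain ⟨j, rfl⟩ := even_iff_exists_two_mul.mp hi
    have hli := Tetrahedron.linearIndependent_a_b_even F j
    obtain ⟨B, hB⟩ := Tetrahedron.exists_basis_of_span_range_eq F hli
      (S := Tetrahedron.U F (2 * j))
      (by rw [Matrix.range_cons_cons_empty, Tetrahedron.U])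
    exact ⟨hli, B, hB 0, hB 1⟩
  · exact (Tetrahedron.iSupIndep_U F).comp Fin.val_injective
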